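/- Let $f:(0,\infty)\to[0,\infty)$ be Lebesgue measurable with $\lambda_t f:=\int_0^t f(x)\,dx<\infty$ for every $t>0$. Let $\Gamma=(\Gamma_t)_{t\ge 0}$ be a standard Gamma process on a probability space: $\Gamma_0=0$ a.s., the paths are a.s. increasing and right-continuous, the increments are independent, and for $s<t$ the increment $\Gamma_t-\Gamma_s$ has the Gamma distribution with shape $t-s$ and rate $1$. Let $\Gamma_t f:=\int_{(0,t]} f\,d\Gamma$ be the pathwise Lebesgue–Stieltjes integral. We say that $f$ satisfies orderly divergence (OD) if $\lambda_t f\to\infty$ and $\Gamma_t f/\lambda_t f\to 1$ in probability as $t\to\infty$. Put $$v_t=\frac{\lambda_t (f^2)}{(\lambda_t f)^2},\qquad \ell_t=\frac{\lambda_{t-1}f}{\lambda_t f},\qquad b_t=\frac{f(t)}{\lambda_t f}.$$ All limits are taken as $t\to\infty$ through the real numbers. (0) If $f$ satisfies OD (with respect to some such $\Gamma$), then $\ell_t\to 1$. (1) If $\int_0^t f(x)^2\,dx<\infty$ for every $t>0$, $f(t)\to\infty$ and $b_t\to 0$, then $v_t\to 0$. (2) If $f$ is monotonic (increasing or decreasing,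 not necessarily strictly) on $(0,\infty)$ and is not almost everywhere equal to $0$, then $\ell_t\to 1$ if and only if $b_t\to 0$. -/

import Mathlib

open MeasureTheory ProbabilityTheory Filter Topology Set
open scoped NNReal

namespace GammaOD

/-- The standard Gamma process on `[0, ∞)` under `P` (so that `Γ 1` is exponential with mean `1`):
it starts at `0`, its paths are almost surely increasing and right-continuous, its increments are
independent, and `Γ t - Γ s` has the Gamma law with shape `t - s` and rate `1` for `s < t`. -/
structure IsGammaProcess {Ω : Type*} [MeasurableSpace Ω] (Γ : ℝ≥0 → Ω → ℝ) (P : Measure Ω) :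
    Prop where
  measurable : ∀ t, Measurable (Γ t)
  start_zero : ∀ᵐ ω ∂P, Γ 0 ω = 0
  paths : ∀ᵐ ω ∂P, Monotone (fun t => Γ t ω) ∧
    ∀ t, ContinuousWithinAt (fun t => Γ t ω) (Ici t) t
  indep_increments : HasIndepIncrements Γ P
  increment_law : ∀ s t : ℝ≥0, s < t →
    HasLaw (fun ω => Γ t ω - Γ s ω) (gammaMeasure ((t : ℝ) - (s : ℝ)) 1) P

/-- An increasing right-continuous path on `[0, ∞)`, extended by its value at `0` to the negative
half-line, as a Stieltjes function. -/
noncomputable def pathStieltjes (γ : ℝ≥0 → ℝ) (hm : Monotone γ)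
    (hc : ∀ t, ContinuousWithinAt γ (Ici t) t) : StieltjesFunction ℝ where
  toFun x := γ x.toNNReal
  mono' _ _ h := hm (Real.toNNReal_mono h)
  right_continuous' x := (hc x.toNNReal).comp continuous_real_toNNReal.continuousWithinAt
    (fun _ hy => Real.toNNReal_mono hy)

open scoped Classical in
/-- The Lebesgue–Stieltjes measure `dγ` of a path `γ`; it gives mass `γ b - γ a` to `(a, b]` for
`0 ≤ a ≤ b`. (It is set to `0` for the paths that are not increasing and right-continuous; for a
Gamma process they form a null set.) -/
noncomputable def pathMeasure (γ : ℝ≥0 → ℝ) : Measure ℝ :=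
  if h : Monotone γ ∧ ∀ t, ContinuousWithinAt γ (Ici t) t then
    (pathStieltjes γ h.1 h.2).measure
  else 0

/-- The pathwise integral `Γ_t f = ∫_{(0,t]} f dΓ`. -/
noncomputable def gammaIntegral {Ω : Type*} (Γ : ℝ≥0 → Ω → ℝ) (f : ℝ → ℝ) (t : ℝ) (ω : Ω) : ℝ :=
  ∫ x in Ioc 0 t, f x ∂(pathMeasure fun s => Γ s ω)

/-- `λ_t f = ∫_0^t f(x) dx`. -/
noncomputable def lam (f : ℝ → ℝ) (t : ℝ) : ℝ := ∫ x in Ioc 0 t, f x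

/-- `v_t = λ_t(f²) / (λ_t f)²`. -/
noncomputable def vRatio (f : ℝ → ℝ) (t : ℝ) : ℝ := lam (fun x => f x ^ 2) t / lam f t ^ 2

/-- `ℓ_t = λ_{t-1} f / λ_t f`. -/
noncomputable def lRatio (f : ℝ → ℝ) (t : ℝ) : ℝ := lam f (t - 1) / lam f t

/-- `b_t = f(t) / λ_t f`. -/
noncomputable def bRatio (f : ℝ → ℝ) (t : ℝ) : ℝ := f t / lam f t

/-- Orderly divergence: `λ_t f → ∞` and `Γ_t f / λ_t f → 1` in probability as `t → ∞`. -/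
def OrderlyDivergent {Ω : Type*} [MeasurableSpace Ω] (Γ : ℝ≥0 → Ω → ℝ) (P : Measure Ω)
    (f : ℝ → ℝ) : Prop :=
  Tendsto (lam f) atTop atTop ∧
    TendstoInMeasure P (fun (t : ℝ) ω => gammaIntegral Γ f t ω / lam f t) atTop (fun _ => (1 : ℝ))

end GammaOD

namespace GammaOD

/-! Only part (0) is probabilistic. Let `X` be the integral of `f` against `dΓ` over `(t - 1, t]`
and `d` its mean. The Laplace functional of `dΓ` and Jensen's inequality for `log` on an interval of
length one give `E exp (-X / d) ≥ 1 / 2` (`IsGammaProcess.le_integral_exp_neg`): on a bounded time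
interval, `X / d` cannot concentrate near `1`. If `ℓ_t ≤ 1 - ε`, then `d ≥ ε λ_t f`, and orderly
divergence at `t - 1` and `t` forces `X / d ≥ 9 / 10` off an event of probability at most `2 / 25`,
so `E exp (-X / d) ≤ exp (-9 / 10) + 2 / 25 < 1 / 2`, a contradiction (`IsGammaProcess.lt_lRatio`).
Parts (1) and (2) are elementary comparisons of `f` with increments of `lam f`; in (1), divergence
of `f` serves only to make `λ_t f` diverge. -/

/-! ### The Gamma law -/

/-- The Laplace transform of the Gamma law of rate `1`. -/
lemma mgf_id_gammaMeasure {a c : ℝ} (ha : 0 < a) (hc : 0 ≤ c) :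
    mgf id (gammaMeasure a 1) (-c) = (1 + c) ^ (-a) := by
  have hm : Measurable (gammaPDF a 1) := (measurable_gammaPDFReal a 1).ennreal_ofReal
  rw [mgf, gammaMeasure, integral_withDensity_eq_integral_toReal_smul hm
    (ae_of_all _ fun x => ENNReal.ofReal_lt_top)]
  have h1 : ∀ x, (gammaPDF a 1 x).toReal • Real.exp (-c * id x) =
      (Ici (0 : ℝ)).indicator
        (fun x => (Real.Gamma a)⁻¹ * (x ^ (a - 1) * Real.exp (-((1 + c) * x)))) x := by
    intro x
    rw [gammaPDF, ENNReal.toReal_ofReal (gammaPDFReal_nonneg ha one_pos x), gammaPDFReal]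
    by_cases hx : 0 ≤ x
    · rw [if_pos hx, indicator_of_mem (mem_Ici.2 hx), smul_eq_mul, Real.one_rpow, one_div,
        mul_assoc, mul_assoc, ← Real.exp_add]
      congr 3
      simp only [id]
      ring_nf
    · rw [if_neg hx, indicator_of_notMem (by simpa using hx), zero_smul]
  simp_rw [h1]
  rw [integral_indicator measurableSet_Ici, integral_Ici_eq_integral_Ioi, integral_const_mul,
    Real.integral_rpow_mul_exp_neg_mul_Ioi ha (by linarith), mul_comm, mul_assoc,
    mul_inv_cancel₀ (Real.Gamma_pos_of_pos ha).ne', mul_one, one_div,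
    Real.inv_rpow (by linarith), Real.rpow_neg (by linarith)]

/-- The mean of the Gamma law of rate `1`. -/
lemma lintegral_id_gammaMeasure {a : ℝ} (ha : 0 < a) :
    ∫⁻ x, ENNReal.ofReal x ∂(gammaMeasure a 1) = ENNReal.ofReal a := by
  have hm : Measurable (gammaPDF a 1) := (measurable_gammaPDFReal a 1).ennreal_ofReal
  -- Size-biasing the law of shape `a` gives shape `a + 1`, so the mean is `a` times a total mass of
  -- one.
  have h1 : ∀ x, gammaPDF a 1 x * ENNReal.ofReal x =
      ENNReal.ofReal a * gammaPDF (a + 1) 1 x := by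
    intro x
    rw [gammaPDF, gammaPDF, ← ENNReal.ofReal_mul (gammaPDFReal_nonneg ha one_pos x),
      ← ENNReal.ofReal_mul ha.le, gammaPDFReal, gammaPDFReal]
    congr 1
    rcases lt_trichotomy x 0 with hx | rfl | hx
    · simp [not_le.2 hx]
    · simp [Real.zero_rpow ha.ne']
    · have h2 : x ^ (a + 1 - 1) = x ^ (a - 1) * x := by
        rw [add_sub_cancel_right, ← Real.rpow_add_one hx.ne', sub_add_cancel]
      rw [if_pos hx.le, if_pos hx.le, Real.one_rpow, Real.one_rpow, Real.Gamma_add_one ha.ne', h2]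
      have := (Real.Gamma_pos_of_pos ha).ne'
      have := ha.ne'
      field_simp
  rw [gammaMeasure, lintegral_withDensity_eq_lintegral_mul _ hm
    ENNReal.measurable_ofReal]
  simp only [Pi.mul_apply, h1]
  have hm' : Measurable (gammaPDF (a + 1) 1) := (measurable_gammaPDFReal _ 1).ennreal_ofReal
  rw [lintegral_const_mul _ hm', lintegral_gammaPDF_eq_one (by linarith) one_pos, mul_one]

/-! ### Random measures and their Laplace functionals -/

section Kernel

variable {Ω E : Type*} [MeasurableSpace Ω] [MeasurableSpace E] {P : Measure Ω}
  {κ : Kernel Ω E}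

lemma ae_integrable_of_integrable_comp {f : E → ℝ} (hf : Integrable f (κ ∘ₘ P)) :
    ∀ᵐ ω ∂P, Integrable f (κ ω) :=
  ((Measure.integrable_comp_iff hf.1).1 hf).1

lemma integrable_integral_of_integrable_comp {f : E → ℝ} (hf : Integrable f (κ ∘ₘ P)) :
    Integrable (fun ω => ∫ x, f x ∂κ ω) P := by
  rw [Measure.comp_eq_comp_const_apply] at hf
  exact hf.integral_comp

lemma integral_integral_of_integrable_comp {f : E → ℝ} (hf : Integrable f (κ ∘ₘ P)) :
    ∫ ω, ∫ x, f x ∂κ ω ∂P = ∫ x, f x ∂(κ ∘ₘ P) := by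
  rw [Measure.comp_eq_comp_const_apply] at hf ⊢
  exact (Kernel.integral_comp hf).symm

lemma ae_integral_nonneg {f : E → ℝ} (hf : ∀ᵐ x ∂(κ ∘ₘ P), 0 ≤ f x) :
    ∀ᵐ ω ∂P, 0 ≤ ∫ x, f x ∂κ ω := by
  filter_upwards [Measure.ae_ae_of_ae_bind κ.measurable.aemeasurable hf] with ω hω
  exact integral_nonneg_of_ae hω

lemma integrable_exp_neg_integral [IsFiniteMeasure P] {f : E → ℝ} (hf : Integrable f (κ ∘ₘ P))
    (hf0 : ∀ᵐ x ∂(κ ∘ₘ P), 0 ≤ f x) :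
    Integrable (fun ω => Real.exp (-∫ x, f x ∂κ ω)) P := by
  refine Integrable.of_bound
    (Real.continuous_exp.comp_aestronglyMeasurable
      (integrable_integral_of_integrable_comp hf).1.neg) 1 ?_
  filter_upwards [ae_integral_nonneg hf0] with ω hω
  rw [Real.norm_eq_abs, Real.abs_exp]
  exact Real.exp_le_one_iff.2 (by linarith)

/-- No sign condition on `y` is needed: for `y ≤ x` the left side is nonpositive, and otherwise the
tangent bound for `exp` applies. -/
lemma exp_neg_sub_exp_neg_le {x y : ℝ} (hx : 0 ≤ x) :
    Real.exp (-x) - Real.exp (-y) ≤ |y - x| := by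
  rcases le_total y x with h | h
  · have := Real.exp_le_exp.2 (neg_le_neg h)
    have := abs_nonneg (y - x)
    linarith
  · have h1 : Real.exp (-y) = Real.exp (-x) * Real.exp (-(y - x)) := by
      rw [← Real.exp_add]; congr 1; ring
    have h2 := Real.add_one_le_exp (-(y - x))
    have h3 : Real.exp (-x) ≤ 1 := Real.exp_le_one_iff.2 (by linarith)
    have h4 := Real.exp_pos (-x)
    rw [abs_of_nonneg (by linarith), h1]
    nlinarith

/-- The Laplace functional is `1`-Lipschitz for the `L¹` norm of the intensity measure. -/
lemma integral_exp_neg_sub_le [IsFiniteMeasure P] {f g : E → ℝ} (hf : Integrable f (κ ∘ₘ P))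
    (hf0 : ∀ᵐ x ∂(κ ∘ₘ P), 0 ≤ f x) (hg : Integrable g (κ ∘ₘ P))
    (hg0 : ∀ᵐ x ∂(κ ∘ₘ P), 0 ≤ g x) :
    ∫ ω, Real.exp (-∫ x, f x ∂κ ω) ∂P - ∫ ω, Real.exp (-∫ x, g x ∂κ ω) ∂P ≤
      ∫ x, |g x - f x| ∂(κ ∘ₘ P) := by
  have hgf : Integrable (fun x => |g x - f x|) (κ ∘ₘ P) := (hg.sub hf).abs
  rw [← integral_sub (integrable_exp_neg_integral hf hf0) (integrable_exp_neg_integral hg hg0),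
    ← integral_integral_of_integrable_comp hgf]
  refine integral_mono_ae
    ((integrable_exp_neg_integral hf hf0).sub (integrable_exp_neg_integral hg hg0))
    (integrable_integral_of_integrable_comp hgf) ?_
  filter_upwards [ae_integral_nonneg hf0,
    ae_integrable_of_integrable_comp hf, ae_integrable_of_integrable_comp hg] with ω h1 h3 h4
  refine (exp_neg_sub_exp_neg_le h1).trans ?_
  rw [← integral_sub h4 h3]
  exact abs_integral_le_integral_abs

end Kernel

/-! ### The random measure `dΓ` and its mean -/

/-- On an interval, the random measure `dΓ` is almost surely given by a kernel whose mean is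
Lebesgue measure. -/
lemma IsGammaProcess.exists_kernel {Ω : Type*} [MeasurableSpace Ω] {P : Measure Ω}
    [IsProbabilityMeasure P] {Γ : ℝ≥0 → Ω → ℝ} (hΓ : IsGammaProcess Γ P) {a b : ℝ} (ha : 0 ≤ a) :
    ∃ κ : Kernel Ω ℝ, (∀ᵐ ω ∂P, κ ω = (pathMeasure fun s => Γ s ω).restrict (Ioc a b)) ∧
      κ ∘ₘ P = volume.restrict (Ioc a b) := by
  classical
  obtain ⟨G, hG, hGm, hGP⟩ : ∃ G : Set Ω, (∀ ω ∈ G, Monotone (fun t => Γ t ω) ∧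
      ∀ t, ContinuousWithinAt (fun t => Γ t ω) (Ici t) t) ∧ MeasurableSet G ∧ ∀ᵐ ω ∂P, ω ∈ G := by
    obtain ⟨G, hGP, hGm, hG⟩ := hΓ.paths.exists_measurable_mem
    exact ⟨G, hG, hGm, hGP⟩
  -- Cutting off outside a measurable set `G` of good paths makes the measure depend measurably on
  -- `ω`.
  let κ₀ : Ω → Measure ℝ := fun ω =>
    if ω ∈ G then (pathMeasure fun s => Γ s ω).restrict (Ioc a b) else 0
  -- The masses of half-open intervals, a π-system, are differences of path values; `ENNReal.ofReal`
  -- absorbs the case of an empty intersection.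
  have hval : ∀ ω, ∀ u v : ℝ, κ₀ ω (Ioc u v) = G.indicator (fun ω => ENNReal.ofReal
      (Γ (min v b).toNNReal ω - Γ (max u a).toNNReal ω)) ω := by
    intro ω u v
    by_cases hω : ω ∈ G
    · simp only [κ₀, if_pos hω, indicator_of_mem hω]
      rw [Measure.restrict_apply measurableSet_Ioc, Ioc_inter_Ioc, pathMeasure,
        dif_pos (hG ω hω), StieltjesFunction.measure_Ioc]
      rfl
    · simp [κ₀, if_neg hω, indicator_of_notMem hω]
  have hvalm : ∀ u v : ℝ, Measurable fun ω => κ₀ ω (Ioc u v) := by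
    intro u v
    simp_rw [hval]
    exact (((hΓ.measurable _).sub (hΓ.measurable _)).ennreal_ofReal).indicator hGm
  have huniv : ∀ ω, κ₀ ω univ = κ₀ ω (Ioc a b) := by
    intro ω
    by_cases hω : ω ∈ G <;> simp [κ₀, hω]
  have hfin : ∀ ω, IsFiniteMeasure (κ₀ ω) := by
    intro ω
    refine ⟨?_⟩
    rw [huniv, hval]
    by_cases hω : ω ∈ G <;> simp [hω]
  have hm : Measurable κ₀ := by
    refine Measurable.measure_of_isPiSystem
      ((BorelSpace.measurable_eq (α := ℝ)).trans (borel_eq_generateFrom_Ioc ℝ))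
      (isPiSystem_Ioc id id) ?_ ?_
    · rintro s ⟨u, v, -, rfl⟩
      exact hvalm u v
    · simp_rw [huniv]
      exact hvalm a b
  refine ⟨⟨κ₀, hm⟩, ?_, ?_⟩
  · filter_upwards [hGP] with ω hω
    simp [κ₀, hω]
  · symm
    refine Measure.ext_of_Ioc _ _ fun u v _ => ?_
    rw [Measure.bind_apply measurableSet_Ioc (Kernel.measurable _).aemeasurable,
      Measure.restrict_apply measurableSet_Ioc, Ioc_inter_Ioc, Real.volume_Ioc]
    change _ = ∫⁻ ω, κ₀ ω (Ioc u v) ∂P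
    simp_rw [hval]
    have h1 : ∫⁻ ω, G.indicator (fun ω => ENNReal.ofReal
        (Γ (min v b).toNNReal ω - Γ (max u a).toNNReal ω)) ω ∂P =
        ∫⁻ ω, ENNReal.ofReal (Γ (min v b).toNNReal ω - Γ (max u a).toNNReal ω) ∂P := by
      refine lintegral_congr_ae ?_
      filter_upwards [hGP] with ω hω
      simp [hω]
    rw [h1]
    have h0 : 0 ≤ max u a := ha.trans (le_max_right _ _)
    change ENNReal.ofReal (min v b - max u a) = _
    rcases lt_or_ge (max u a) (min v b) with h | h
    · have hlaw := hΓ.increment_law (max u a).toNNReal (min v b).toNNReal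
        ((Real.toNNReal_lt_toNNReal_iff (h0.trans_lt h)).2 h)
      rw [Real.coe_toNNReal _ h0, Real.coe_toNNReal _ (h0.trans h.le)] at hlaw
      rw [← lintegral_id_gammaMeasure (sub_pos.2 h), ← hlaw.map_eq,
        lintegral_map' (by fun_prop) hlaw.aemeasurable]
    · rw [ENNReal.ofReal_of_nonpos (by linarith), eq_comm]
      refine lintegral_eq_zero_of_ae_eq_zero ?_
      filter_upwards [hΓ.paths] with ω hω
      simpa using hω.1 (Real.toNNReal_mono h)

lemma pathMeasure_Ioc {γ : ℝ≥0 → ℝ} (h : Monotone γ ∧ ∀ t, ContinuousWithinAt γ (Ici t) t)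
    (u v : ℝ) : pathMeasure γ (Ioc u v) = ENNReal.ofReal (γ v.toNNReal - γ u.toNNReal) := by
  rw [pathMeasure, dif_pos h, StieltjesFunction.measure_Ioc]
  rfl

/-! ### Step functions -/

/-- The step function with value `c i` on the `i`-th of `n` adjacent intervals of length `1 / n`
that start at `a`. -/
noncomputable def stepFun (a : ℝ) (n : ℕ) (c : ℕ → ℝ) (x : ℝ) : ℝ :=
  ∑ i ∈ Finset.range n, (Ioc (a + i / n) (a + (i + 1 : ℕ) / n)).indicator (fun _ => c i) x

lemma stepFun_nonneg {a : ℝ} {n : ℕ} {c : ℕ → ℝ} (hc : ∀ i, 0 ≤ c i) (x : ℝ) :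
    0 ≤ stepFun a n c x :=
  Finset.sum_nonneg fun i _ => indicator_nonneg (fun _ _ => hc i) x

lemma integrable_stepFun {μ : Measure ℝ} [IsFiniteMeasure μ] (a : ℝ) (n : ℕ) (c : ℕ → ℝ) :
    Integrable (stepFun a n c) μ :=
  integrable_finsetSum _ fun _ _ => (integrable_const _).indicator measurableSet_Ioc

lemma integral_stepFun {μ : Measure ℝ} [IsFiniteMeasure μ] (a : ℝ) (n : ℕ) (c : ℕ → ℝ) :
    ∫ x, stepFun a n c x ∂μ =
      ∑ i ∈ Finset.range n, c i * μ.real (Ioc (a + i / n) (a + (i + 1 : ℕ) / n)) := by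
  simp only [stepFun]
  rw [integral_finsetSum _ fun _ _ => (integrable_const _).indicator measurableSet_Ioc]
  refine Finset.sum_congr rfl fun i _ => ?_
  rw [integral_indicator_const _ measurableSet_Ioc, smul_eq_mul, mul_comm]

/-- At every point of `(a, a + 1]`, the step function takes the value of its interval. -/
lemma exists_stepFun_eq {a : ℝ} {n : ℕ} (hn : 0 < n) (c : ℕ → ℝ) {x : ℝ}
    (hx : x ∈ Ioc a (a + 1)) :
    ∃ i : ℕ, x ∈ Ioc (a + i / n) (a + (i + 1 : ℕ) / n) ∧ stepFun a n c x = c i := by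
  have hn' : (0 : ℝ) < n := Nat.cast_pos.2 hn
  -- The cells are open on the left and closed on the right, so the index comes from a ceiling minus
  -- one.
  have hmem : ∀ i : ℕ, x ∈ Ioc (a + i / n) (a + (i + 1 : ℕ) / n) ↔ ⌈(x - a) * n⌉₊ = i + 1 := by
    intro i
    rw [Nat.ceil_eq_iff (Nat.succ_ne_zero i), mem_Ioc, Nat.succ_sub_one, ← sub_le_iff_le_add',
      ← lt_sub_iff_add_lt', le_div_iff₀ hn', div_lt_iff₀ hn']
  have h0 : 0 < ⌈(x - a) * n⌉₊ := Nat.ceil_pos.2 (mul_pos (sub_pos.2 hx.1) hn')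
  have h1 : ⌈(x - a) * n⌉₊ ≤ n := by
    rw [Nat.ceil_le]
    have := hx.2
    nlinarith
  have h2 : ⌈(x - a) * n⌉₊ = (⌈(x - a) * n⌉₊ - 1) + 1 := by omega
  refine ⟨⌈(x - a) * n⌉₊ - 1, (hmem _).2 h2, ?_⟩
  rw [stepFun, Finset.sum_eq_single (⌈(x - a) * n⌉₊ - 1), indicator_of_mem ((hmem _).2 h2)]
  · intro j _ hj
    refine indicator_of_notMem (fun h => hj ?_) _
    have := (hmem j).1 h
    omega
  · intro h
    exact absurd (Finset.mem_range.2 (by omega)) h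

/-! ### The Laplace functional of the Gamma process -/

section Laplace

variable {Ω : Type*} [MeasurableSpace Ω] {P : Measure Ω} {Γ : ℝ≥0 → Ω → ℝ}

/-- The Laplace functional of `dΓ` on step functions. -/
lemma IsGammaProcess.integral_exp_neg_sum (hΓ : IsGammaProcess Γ P) {a : ℝ} (ha : 0 ≤ a) {n : ℕ}
    (hn : 0 < n) {c : ℕ → ℝ} (hc : ∀ i, 0 ≤ c i) :
    ∫ ω, Real.exp (-∑ i ∈ Finset.range n, c i * (Γ (a + (i + 1 : ℕ) / n).toNNReal ω -
      Γ (a + i / n).toNNReal ω)) ∂P = ∏ i ∈ Finset.range n, (1 + c i) ^ (-(1 / n : ℝ)) := by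
  have hn' : (0 : ℝ) < n := Nat.cast_pos.2 hn
  let p : ℕ → ℝ≥0 := fun i => (a + i / n).toNNReal
  have hp : Monotone p := fun i j hij => Real.toNNReal_mono (by gcongr)
  let X : ℕ → Ω → ℝ := fun i ω => c i * (Γ (p (i + 1)) ω - Γ (p i) ω)
  have hX : iIndepFun X P :=
    (hΓ.indep_increments.nat hp).comp (fun i x => c i * x) fun i => by fun_prop
  have hXm : ∀ i, Measurable (X i) := fun i =>
    ((hΓ.measurable _).sub (hΓ.measurable _)).const_mul _
  have hmgf : ∀ i, mgf (X i) P (-1) = (1 + c i) ^ (-(1 / n : ℝ)) := by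
    intro i
    have h0 : 0 ≤ a + i / n := by positivity
    have h1 : a + i / n < a + (i + 1 : ℕ) / n := by gcongr; simp
    have hlaw := hΓ.increment_law (p i) (p (i + 1))
      ((Real.toNNReal_lt_toNNReal_iff (h0.trans_lt h1)).2 h1)
    simp only [p] at hlaw
    rw [Real.coe_toNNReal _ h0, Real.coe_toNNReal _ (h0.trans h1.le)] at hlaw
    have h2 : a + (i + 1 : ℕ) / n - (a + i / n) = (1 / n : ℝ) := by
      push_cast
      ring
    rw [h2] at hlaw
    rw [← mgf_id_gammaMeasure (by positivity) (hc i), ← hlaw.map_eq,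
      mgf_id_map hlaw.aemeasurable]
    simp only [X, p]
    rw [mgf_const_mul, mul_neg_one]
  rw [← Finset.prod_congr rfl fun i _ => hmgf i, ← hX.mgf_sum hXm, mgf]
  refine integral_congr_ae (ae_of_all _ fun ω => ?_)
  simp only [Finset.sum_apply, X, p, neg_one_mul]

/-- Jensen's inequality in discrete form: AM-GM with weights `1 / n`, which sum to one because the
interval has length one. -/
lemma prod_rpow_neg_ge {n : ℕ} (hn : 0 < n) {c : ℕ → ℝ} (hc : ∀ i, 0 ≤ c i) :
    (1 + ∑ i ∈ Finset.range n, c i * (1 / n : ℝ))⁻¹ ≤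
      ∏ i ∈ Finset.range n, (1 + c i) ^ (-(1 / n : ℝ)) := by
  have hn' : (0 : ℝ) < n := Nat.cast_pos.2 hn
  have hc' : ∀ i, 0 < 1 + c i := fun i => by linarith [hc i]
  have h1 := Real.geom_mean_le_arith_mean_weighted (Finset.range n) (fun _ => (1 / n : ℝ))
    (fun i => 1 + c i) (fun _ _ => by positivity) (by simp [hn'.ne']) fun i _ => (hc' i).le
  have h2 : ∑ i ∈ Finset.range n, (1 / n : ℝ) * (1 + c i) =
      1 + ∑ i ∈ Finset.range n, c i * (1 / n : ℝ) := by
    simp_rw [mul_add, Finset.sum_add_distrib, mul_comm (c _)]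
    simp [hn'.ne']
  simp_rw [Real.rpow_neg (hc' _).le]
  rw [Finset.prod_inv_distrib, ← h2]
  exact inv_anti₀ (Finset.prod_pos fun i _ => Real.rpow_pos_of_pos (hc' i) _) h1

lemma IsGammaProcess.le_integral_exp_neg_stepFun (hΓ : IsGammaProcess Γ P) {a : ℝ} (ha : 0 ≤ a)
    {κ : Kernel Ω ℝ}
    (hκ : ∀ᵐ ω ∂P, κ ω = (pathMeasure fun s => Γ s ω).restrict (Ioc a (a + 1)))
    {n : ℕ} (hn : 0 < n) {c : ℕ → ℝ} (hc : ∀ i, 0 ≤ c i) :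
    (1 + ∫ x in Ioc a (a + 1), stepFun a n c x)⁻¹ ≤
      ∫ ω, Real.exp (-∫ x, stepFun a n c x ∂κ ω) ∂P := by
  have hn' : (0 : ℝ) < n := Nat.cast_pos.2 hn
  have hsub : ∀ i < n, Ioc (a + i / n) (a + (i + 1 : ℕ) / n) ⊆ Ioc a (a + 1) := by
    intro i hi
    refine Ioc_subset_Ioc (le_add_of_nonneg_right (by positivity)) (by
      gcongr
      rw [div_le_one hn']
      exact_mod_cast hi)
  have hle : ∀ i : ℕ, a + i / n ≤ a + (i + 1 : ℕ) / n := fun i => by gcongr; simp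
  have h1 : ∫ x in Ioc a (a + 1), stepFun a n c x =
      ∑ i ∈ Finset.range n, c i * (1 / n : ℝ) := by
    rw [integral_stepFun]
    refine Finset.sum_congr rfl fun i hi => ?_
    rw [measureReal_restrict_apply measurableSet_Ioc,
      inter_eq_left.2 (hsub i (Finset.mem_range.1 hi)), Real.volume_real_Ioc_of_le (hle i)]
    push_cast
    ring
  have h2 : ∫ ω, Real.exp (-∫ x, stepFun a n c x ∂κ ω) ∂P =
      ∫ ω, Real.exp (-∑ i ∈ Finset.range n, c i * (Γ (a + (i + 1 : ℕ) / n).toNNReal ω -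
      Γ (a + i / n).toNNReal ω)) ∂P := by
    refine integral_congr_ae ?_
    filter_upwards [hκ, hΓ.paths] with ω hω hpath
    have hfin : IsFiniteMeasure (κ ω) := ⟨by
      rw [hω, Measure.restrict_apply_univ, pathMeasure_Ioc hpath]
      exact ENNReal.ofReal_lt_top⟩
    rw [integral_stepFun]
    congr 2
    refine Finset.sum_congr rfl fun i hi => ?_
    rw [hω, measureReal_restrict_apply measurableSet_Ioc,
      inter_eq_left.2 (hsub i (Finset.mem_range.1 hi)), measureReal_def, pathMeasure_Ioc hpath,
      ENNReal.toReal_ofReal (sub_nonneg.2 (hpath.1 (Real.toNNReal_mono (hle i))))]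
  rw [h1, h2, hΓ.integral_exp_neg_sum ha hn hc]
  exact prod_rpow_neg_ge hn hc

/-- Nonnegative integrable functions on `(a, a + 1]` are limits in mean of step functions. -/
lemma exists_stepFun_integral_sub_le {g : ℝ → ℝ} {a : ℝ}
    (hg : IntegrableOn g (Ioc a (a + 1))) (hg0 : ∀ x ∈ Ioc a (a + 1), 0 ≤ g x) {ε : ℝ}
    (hε : 0 < ε) :
    ∃ n : ℕ, 0 < n ∧ ∃ c : ℕ → ℝ, (∀ i, 0 ≤ c i) ∧
      ∫ x in Ioc a (a + 1), |g x - stepFun a n c x| ≤ ε := by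
  obtain ⟨h, hcs, hgh, hcont, hint⟩ := hg.exists_hasCompactSupport_integral_sub_le (half_pos hε)
  obtain ⟨δ, hδ, hu⟩ := Metric.uniformContinuous_iff.1
    (hcs.uniformContinuous_of_continuous hcont) (ε / 2) (half_pos hε)
  obtain ⟨m, hm⟩ := exists_nat_one_div_lt hδ
  -- The continuous approximant is sampled at right endpoints. Taking positive parts makes the
  -- values nonnegative without moving them away from `g ≥ 0`.
  refine ⟨m + 1, m.succ_pos, fun i => max (h (a + (i + 1 : ℕ) / (m + 1 : ℕ))) 0,
    fun i => le_max_right _ _, ?_⟩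
  set c : ℕ → ℝ := fun i => max (h (a + (i + 1 : ℕ) / (m + 1 : ℕ))) 0
  have key : ∀ x ∈ Ioc a (a + 1), |g x - stepFun a (m + 1) c x| ≤ ‖g x - h x‖ + ε / 2 := by
    intro x hx
    obtain ⟨i, hi, hs⟩ := exists_stepFun_eq m.succ_pos c hx
    have h1 : |max (h x) 0 - c i| ≤ ε / 2 := by
      refine (abs_max_sub_max_le_abs _ _ _).trans ?_
      rw [← Real.dist_eq]
      refine (hu ?_).le
      rw [Real.dist_eq, abs_sub_comm, abs_of_nonneg (by linarith [hi.2])]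
      have h2 : a + (i + 1 : ℕ) / (m + 1 : ℕ) - (a + i / (m + 1 : ℕ)) = 1 / ((m : ℝ) + 1) := by
        push_cast
        ring
      linarith [hi.1]
    have h2 : |g x - max (h x) 0| ≤ |g x - h x| := by
      have := abs_max_sub_max_le_abs (g x) (h x) 0
      rwa [max_eq_left (hg0 x hx)] at this
    rw [hs, Real.norm_eq_abs]
    have := abs_sub_le (g x) (max (h x) 0) (c i)
    linarith
  calc _ ≤ ∫ x in Ioc a (a + 1), (‖g x - h x‖ + ε / 2) :=
        setIntegral_mono_on (hg.sub (integrable_stepFun _ _ _)).abs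
          ((hg.sub hint).norm.add (integrable_const _)) measurableSet_Ioc key
    _ = (∫ x in Ioc a (a + 1), ‖g x - h x‖) + ε / 2 := by
        rw [integral_add (f := fun x => ‖g x - h x‖) (hg.sub hint).norm (integrable_const _)]
        simp
    _ ≤ ε := by linarith

variable [IsProbabilityMeasure P]

/-- By Jensen's inequality, the integral of `g` over an interval of length `1` against `dΓ`
dominates `(∫ g) · Γ₁` in the Laplace transform order. -/
lemma IsGammaProcess.le_integral_exp_neg (hΓ : IsGammaProcess Γ P) {a : ℝ} (ha : 0 ≤ a)
    {κ : Kernel Ω ℝ}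
    (hκ : ∀ᵐ ω ∂P, κ ω = (pathMeasure fun s => Γ s ω).restrict (Ioc a (a + 1)))
    (hmean : κ ∘ₘ P = volume.restrict (Ioc a (a + 1))) {g : ℝ → ℝ}
    (hg : IntegrableOn g (Ioc a (a + 1))) (hg0 : ∀ x ∈ Ioc a (a + 1), 0 ≤ g x) :
    (1 + ∫ x in Ioc a (a + 1), g x)⁻¹ ≤ ∫ ω, Real.exp (-∫ x, g x ∂κ ω) ∂P := by
  have hI : 0 ≤ ∫ x in Ioc a (a + 1), g x := setIntegral_nonneg measurableSet_Ioc hg0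
  -- An `L¹` error `ε` costs `ε` inside the inverse and, by the Lipschitz bound, `ε` in the Laplace
  -- functional; then `ε` tends to `0`.
  have hmain : ∀ ε > 0, (1 + (∫ x in Ioc a (a + 1), g x) + ε)⁻¹ ≤
      ∫ ω, Real.exp (-∫ x, g x ∂κ ω) ∂P + ε := by
    intro ε hε
    obtain ⟨n, hn, c, hc, hgc⟩ := exists_stepFun_integral_sub_le hg hg0 hε
    have h1 := hΓ.le_integral_exp_neg_stepFun ha hκ hn hc
    have hs : IntegrableOn (stepFun a n c) (Ioc a (a + 1)) := integrable_stepFun _ _ _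
    have h2 := integral_exp_neg_sub_le (κ := κ) (P := P) (f := stepFun a n c) (g := g)
      (by rwa [hmean]) (ae_of_all _ (stepFun_nonneg hc)) (by rwa [hmean])
      (by rw [hmean]; exact (ae_restrict_mem measurableSet_Ioc).mono hg0)
    rw [hmean] at h2
    have h3 : (∫ x in Ioc a (a + 1), stepFun a n c x) - ∫ x in Ioc a (a + 1), g x ≤ ε := by
      rw [← integral_sub hs hg]
      refine (le_abs_self _).trans (abs_integral_le_integral_abs.trans ?_)
      simpa only [abs_sub_comm] using hgc
    have h4 : 0 ≤ ∫ x in Ioc a (a + 1), stepFun a n c x :=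
      integral_nonneg (stepFun_nonneg hc)
    have h5 : (1 + (∫ x in Ioc a (a + 1), g x) + ε)⁻¹ ≤
        (1 + ∫ x in Ioc a (a + 1), stepFun a n c x)⁻¹ :=
      inv_anti₀ (by linarith) (by linarith)
    linarith
  have hl : Tendsto (fun ε : ℝ => (1 + (∫ x in Ioc a (a + 1), g x) + ε)⁻¹) (𝓝[>] 0)
      (𝓝 (1 + ∫ x in Ioc a (a + 1), g x)⁻¹) := by
    refine tendsto_nhdsWithin_of_tendsto_nhds (Tendsto.inv₀ ?_ (by linarith))
    simpa using (continuous_const.add continuous_id).tendsto'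
      (f := fun ε : ℝ => 1 + (∫ x in Ioc a (a + 1), g x) + ε) 0 _ rfl
  have hr : Tendsto (fun ε : ℝ => ∫ ω, Real.exp (-∫ x, g x ∂κ ω) ∂P + ε) (𝓝[>] 0)
      (𝓝 (∫ ω, Real.exp (-∫ x, g x ∂κ ω) ∂P)) := by
    refine tendsto_nhdsWithin_of_tendsto_nhds ?_
    simpa using (continuous_const.add continuous_id).tendsto'
      (f := fun ε : ℝ => ∫ ω, Real.exp (-∫ x, g x ∂κ ω) ∂P + ε) 0 _ rfl
  exact le_of_tendsto_of_tendsto hl hr (eventually_mem_nhdsWithin.mono hmain)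

end Laplace

/-! ### Deterministic estimates for the three ratios -/

section Deterministic

variable {f : ℝ → ℝ}

lemma lam_mono (hf0 : ∀ x, 0 < x → 0 ≤ f x)
    (hf : ∀ t, 0 < t → IntegrableOn f (Ioc 0 t) volume) : Monotone (lam f) := by
  intro s t hst
  rcases le_or_gt t 0 with ht | ht
  · simp [lam, Ioc_eq_empty_of_le ht, Ioc_eq_empty_of_le (hst.trans ht)]
  · refine setIntegral_mono_set (hf t ht) ?_ (Ioc_subset_Ioc_right hst).eventuallyLE
    filter_upwards [ae_restrict_mem measurableSet_Ioc] with x hx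
    exact hf0 x hx.1

lemma lam_sub_lam (hf : ∀ t, 0 < t → IntegrableOn f (Ioc 0 t) volume) {s t : ℝ} (hs : 0 ≤ s)
    (hst : s ≤ t) : lam f t - lam f s = ∫ x in Ioc s t, f x := by
  rcases hs.eq_or_lt with rfl | hs'
  · simp [lam]
  · have := setIntegral_union (μ := volume) (f := f) (Ioc_disjoint_Ioc_of_le (a := 0) le_rfl)
      measurableSet_Ioc (hf s hs') ((hf t (hs'.trans_le hst)).mono_set (Ioc_subset_Ioc_left hs))
    rw [Ioc_union_Ioc_eq_Ioc hs hst] at this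
    simp only [lam, this]
    ring

lemma lam_sub_lam_le (hf : ∀ t, 0 < t → IntegrableOn f (Ioc 0 t) volume) {s t c : ℝ} (hs : 0 ≤ s)
    (hst : s ≤ t) (h : ∀ x ∈ Ioc s t, f x ≤ c) : lam f t - lam f s ≤ c * (t - s) := by
  rcases hst.eq_or_lt with rfl | hst'
  · simp
  rw [lam_sub_lam hf hs hst]
  have := setIntegral_mono_on (μ := volume) (g := fun _ => c)
    ((hf t (hs.trans_lt hst')).mono_set (Ioc_subset_Ioc_left hs)) (by simp) measurableSet_Ioc h
  refine this.trans_eq ?_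
  simp [hst, mul_comm]

lemma le_lam_sub_lam (hf : ∀ t, 0 < t → IntegrableOn f (Ioc 0 t) volume) {s t c : ℝ} (hs : 0 ≤ s)
    (hst : s ≤ t) (h : ∀ x ∈ Ioc s t, c ≤ f x) : c * (t - s) ≤ lam f t - lam f s := by
  rcases hst.eq_or_lt with rfl | hst'
  · simp
  rw [lam_sub_lam hf hs hst]
  have := setIntegral_mono_on (μ := volume) (f := fun _ => c) (by simp)
    ((hf t (hs.trans_lt hst')).mono_set (Ioc_subset_Ioc_left hs)) measurableSet_Ioc h
  refine Eq.trans_le ?_ this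
  simp [hst, mul_comm]

lemma tendsto_lam_atTop (hf0 : ∀ x, 0 < x → 0 ≤ f x)
    (hf : ∀ t, 0 < t → IntegrableOn f (Ioc 0 t) volume) (h : Tendsto f atTop atTop) :
    Tendsto (lam f) atTop atTop := by
  obtain ⟨T, hT⟩ := eventually_atTop.1 (h.eventually_ge_atTop 1)
  refine tendsto_atTop_mono' atTop ?_
    (tendsto_atTop_add_const_right atTop (-(max T 0)) tendsto_id)
  filter_upwards [eventually_ge_atTop (max T 0)] with t ht
  have h1 := le_lam_sub_lam hf (c := 1) (le_max_right T 0) ht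
    fun x hx => hT x ((le_max_left T 0).trans hx.1.le)
  have h2 : lam f 0 ≤ lam f (max T 0) := lam_mono hf0 hf (le_max_right _ _)
  have h3 : lam f 0 = 0 := by simp [lam]
  simp only [id]
  linarith

/-- The sum `λ_t (f²)` is of smaller order than `(λ_t f)²` when `f` is of smaller order than
`λ f`. -/
lemma tendsto_vRatio (hf0 : ∀ x, 0 < x → 0 ≤ f x)
    (hf : ∀ t, 0 < t → IntegrableOn f (Ioc 0 t) volume)
    (h2 : ∀ t, 0 < t → MemLp f 2 (volume.restrict (Ioc 0 t)))
    (hlam : Tendsto (lam f) atTop atTop) (hb : Tendsto (bRatio f) atTop (𝓝 0)) :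
    Tendsto (vRatio f) atTop (𝓝 0) := by
  have hsq : ∀ t, 0 < t → IntegrableOn (fun x => f x ^ 2) (Ioc 0 t) volume :=
    fun t ht => (h2 t ht).integrable_sq
  have hsq0 : ∀ x, 0 < x → 0 ≤ f x ^ 2 := fun x _ => sq_nonneg _
  have hpos : ∀ t, 0 ≤ vRatio f t := fun t =>
    div_nonneg (setIntegral_nonneg measurableSet_Ioc fun x hx => hsq0 x hx.1) (sq_nonneg _)
  rw [Metric.tendsto_atTop']
  intro ε hε
  obtain ⟨T, hT⟩ := eventually_atTop.1
    (((hb.eventually_lt_const (half_pos hε)).and (hlam.eventually_gt_atTop 0)).and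
      (eventually_gt_atTop 0))
  have hT0 : 0 < T := (hT T le_rfl).2
  have key : ∀ t, T ≤ t → lam (fun x => f x ^ 2) t ≤
      lam (fun x => f x ^ 2) T + ε / 2 * lam f t ^ 2 := by
    intro t ht
    have h3 := lam_sub_lam hsq hT0.le ht
    -- For `x` in `(T, t]`, `f x ≤ ε / 2 * lam f x ≤ ε / 2 * lam f t`; one factor of `f ^ 2` is
    -- replaced by this bound.
    have h4 : ∫ x in Ioc T t, f x ^ 2 ≤ ∫ x in Ioc T t, ε / 2 * lam f t * f x := by
      refine setIntegral_mono_on ((hsq t (hT0.trans_le ht)).mono_set (Ioc_subset_Ioc_left hT0.le))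
        (((hf t (hT0.trans_le ht)).mono_set (Ioc_subset_Ioc_left hT0.le)).const_mul _)
        measurableSet_Ioc fun x hx => ?_
      obtain ⟨⟨h5, h6⟩, h7⟩ := hT x hx.1.le
      rw [bRatio, div_lt_iff₀ h6] at h5
      have h8 : lam f x ≤ lam f t := lam_mono hf0 hf hx.2
      have h9 := hf0 x h7
      have h10 : ε / 2 * lam f x ≤ ε / 2 * lam f t := by gcongr
      rw [sq]
      exact mul_le_mul_of_nonneg_right (h5.le.trans h10) h9
    rw [integral_const_mul, ← lam_sub_lam hf hT0.le ht] at h4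
    have h5 := (hT T le_rfl).1.2
    have h6 := (hT t ht).1.2
    have h7 : 0 ≤ ε / 2 * lam f t * lam f T := by positivity
    nlinarith
  have hlim : Tendsto (fun t => lam (fun x => f x ^ 2) T / lam f t ^ 2) atTop (𝓝 0) :=
    ((tendsto_pow_atTop two_ne_zero).comp hlam).const_div_atTop _
  obtain ⟨S, hS⟩ := eventually_atTop.1 (hlim.eventually_lt_const (half_pos hε))
  refine ⟨max S T, fun t ht => ?_⟩
  have h1 := hS t ((le_max_left _ _).trans ht.le)
  have h2 := key t ((le_max_right _ _).trans ht.le)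
  have h3 := (hT t ((le_max_right _ _).trans ht.le)).1.2
  have h4 : 0 < lam f t ^ 2 := by positivity
  rw [Real.dist_eq, sub_zero, abs_of_nonneg (hpos t), vRatio]
  calc _ ≤ (lam (fun x => f x ^ 2) T + ε / 2 * lam f t ^ 2) / lam f t ^ 2 := by gcongr
    _ = lam (fun x => f x ^ 2) T / lam f t ^ 2 + ε / 2 := by field_simp
    _ < ε := by linarith

lemma bRatio_nonneg (hf0 : ∀ x, 0 < x → 0 ≤ f x) {t : ℝ} (ht : 0 < t) : 0 ≤ bRatio f t :=
  div_nonneg (hf0 t ht) (setIntegral_nonneg measurableSet_Ioc fun x hx => hf0 x hx.1)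

lemma lRatio_le_one (hf0 : ∀ x, 0 < x → 0 ≤ f x)
    (hf : ∀ t, 0 < t → IntegrableOn f (Ioc 0 t) volume) (t : ℝ) : lRatio f t ≤ 1 :=
  div_le_one_of_le₀ (lam_mono hf0 hf (by linarith))
    (setIntegral_nonneg measurableSet_Ioc fun x hx => hf0 x hx.1)

lemma eventually_lam_pos (hf0 : ∀ x, 0 < x → 0 ≤ f x)
    (hf : ∀ t, 0 < t → IntegrableOn f (Ioc 0 t) volume) (hpos : ∃ t, 0 < lam f t) :
    ∀ᶠ t in atTop, 0 < lam f t := by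
  obtain ⟨s, hs⟩ := hpos
  filter_upwards [eventually_ge_atTop s] with t ht
  exact hs.trans_le (lam_mono hf0 hf ht)

/-- Comparing `f t` with its averages over `(t, t + 1]` and `(t - 1, t]` gives `b_t ≤ 1 / ℓ_{t+1} -
1` and `1 - b_t ≤ ℓ_t`. -/
lemma tendsto_lRatio_iff_of_monotoneOn (hf0 : ∀ x, 0 < x → 0 ≤ f x)
    (hf : ∀ t, 0 < t → IntegrableOn f (Ioc 0 t) volume) (hmono : MonotoneOn f (Ioi 0))
    (hpos : ∃ t, 0 < lam f t) :
    Tendsto (lRatio f) atTop (𝓝 1) ↔ Tendsto (bRatio f) atTop (𝓝 0) := by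
  have hev := eventually_lam_pos hf0 hf hpos
  constructor
  · intro h
    have h1 : Tendsto (fun t => (lRatio f (t + 1))⁻¹ - 1) atTop (𝓝 0) := by
      simpa using ((h.comp (tendsto_atTop_add_const_right atTop 1 tendsto_id)).inv₀
        one_ne_zero).sub_const 1
    refine squeeze_zero' ?_ ?_ h1
    · filter_upwards [eventually_gt_atTop 0] with t ht using bRatio_nonneg hf0 ht
    · filter_upwards [eventually_gt_atTop 0, hev] with t ht hl
      have h2 := le_lam_sub_lam hf (c := f t) ht.le (by linarith : t ≤ t + 1)
        fun x hx => hmono ht (ht.trans hx.1) hx.1.le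
      rw [lRatio, inv_div, add_sub_cancel_right, bRatio, div_sub_one hl.ne']
      gcongr
      linarith
  · intro h
    have h1 : Tendsto (fun t => 1 - bRatio f t) atTop (𝓝 1) := by simpa using h.const_sub 1
    refine tendsto_of_tendsto_of_tendsto_of_le_of_le' h1 tendsto_const_nhds ?_
      (Eventually.of_forall (lRatio_le_one hf0 hf))
    filter_upwards [eventually_gt_atTop 1, hev] with t ht hl
    have h2 := lam_sub_lam_le hf (c := f t) (by linarith : 0 ≤ t - 1) (by linarith : t - 1 ≤ t)
      fun x hx => hmono (mem_Ioi.2 (by linarith [hx.1])) (mem_Ioi.2 (by linarith)) hx.2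
    rw [lRatio, bRatio, one_sub_div hl.ne']
    gcongr
    linarith

/-- Here `t * f t ≤ λ_t f`, hence `b_t ≤ 1 / t`. -/
lemma tendsto_bRatio_of_antitoneOn (hf0 : ∀ x, 0 < x → 0 ≤ f x)
    (hf : ∀ t, 0 < t → IntegrableOn f (Ioc 0 t) volume) (hanti : AntitoneOn f (Ioi 0))
    (hpos : ∃ t, 0 < lam f t) : Tendsto (bRatio f) atTop (𝓝 0) := by
  refine squeeze_zero' ?_ ?_ tendsto_inv_atTop_zero
  · filter_upwards [eventually_gt_atTop 0] with t ht using bRatio_nonneg hf0 ht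
  · filter_upwards [eventually_gt_atTop 0, eventually_lam_pos hf0 hf hpos] with t ht hl
    have h2 := le_lam_sub_lam hf (c := f t) le_rfl ht.le
      fun x hx => hanti hx.1 ht hx.2
    have h3 : lam f 0 = 0 := by simp [lam]
    rw [bRatio, div_le_iff₀ hl, le_inv_mul_iff₀ ht]
    linarith

/-- The increment over `(t - 1, t]` is at most `f (t - 1)`, so `1 - ℓ_t ≤ b_{t-1}`. -/
lemma tendsto_lRatio_of_antitoneOn (hf0 : ∀ x, 0 < x → 0 ≤ f x)
    (hf : ∀ t, 0 < t → IntegrableOn f (Ioc 0 t) volume) (hanti : AntitoneOn f (Ioi 0))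
    (hpos : ∃ t, 0 < lam f t) : Tendsto (lRatio f) atTop (𝓝 1) := by
  have hb := (tendsto_bRatio_of_antitoneOn hf0 hf hanti hpos).comp
    (tendsto_atTop_add_const_right atTop (-1) tendsto_id)
  have h1 : Tendsto (fun t => 1 - bRatio f (t - 1)) atTop (𝓝 1) := by
    simpa [sub_eq_add_neg] using hb.const_sub 1
  refine tendsto_of_tendsto_of_tendsto_of_le_of_le' h1 tendsto_const_nhds ?_
    (Eventually.of_forall (lRatio_le_one hf0 hf))
  filter_upwards [eventually_gt_atTop 1, (tendsto_atTop_add_const_right atTop (-1 : ℝ)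
    tendsto_id).eventually (eventually_lam_pos hf0 hf hpos)] with t ht hl
  simp only [id, ← sub_eq_add_neg] at hl
  have h2 := lam_sub_lam_le hf (c := f (t - 1)) (by linarith : 0 ≤ t - 1)
    (by linarith : t - 1 ≤ t)
    fun x hx => hanti (mem_Ioi.2 (by linarith)) (mem_Ioi.2 (by linarith [hx.1])) hx.1.le
  have h3 : lam f (t - 1) ≤ lam f t := lam_mono hf0 hf (by linarith)
  have h4 : 0 < lam f t := hl.trans_le h3
  have h5 := hf0 (t - 1) (by linarith)
  have h6 : 1 - lRatio f t ≤ bRatio f (t - 1) := by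
    rw [lRatio, bRatio, one_sub_div h4.ne']
    gcongr
    linarith
  linarith

end Deterministic

/-! ### Orderly divergence forces `ℓ_t → 1` -/

section Divergence

variable {Ω : Type*} [MeasurableSpace Ω] {P : Measure Ω} [IsProbabilityMeasure P]
  {Γ : ℝ≥0 → Ω → ℝ} {f : ℝ → ℝ}

/-- Additivity of the Bochner integral needs pathwise integrability, which holds almost surely
because the mean of `dΓ` is Lebesgue measure. -/
lemma IsGammaProcess.ae_gammaIntegral_sub (hΓ : IsGammaProcess Γ P)
    (hf : ∀ t, 0 < t → IntegrableOn f (Ioc 0 t) volume) {s t : ℝ} (hs : 0 ≤ s) (hst : s ≤ t)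
    (ht : 0 < t) :
    ∀ᵐ ω ∂P, gammaIntegral Γ f t ω - gammaIntegral Γ f s ω =
      ∫ x in Ioc s t, f x ∂(pathMeasure fun s => Γ s ω) := by
  obtain ⟨κ, hκ, hmean⟩ := hΓ.exists_kernel (a := 0) (b := t) le_rfl
  have hint : Integrable f (κ ∘ₘ P) := by
    rw [hmean]
    exact hf t ht
  filter_upwards [hκ, ae_integrable_of_integrable_comp hint] with ω hω hi
  rw [hω] at hi
  change IntegrableOn f (Ioc 0 t) _ at hi
  have := setIntegral_union (μ := pathMeasure fun s => Γ s ω) (f := f)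
    (Ioc_disjoint_Ioc_of_le (a := 0) (d := t) (le_refl s)) measurableSet_Ioc
    (hi.mono_set (Ioc_subset_Ioc_right hst)) (hi.mono_set (Ioc_subset_Ioc_left hs))
  rw [Ioc_union_Ioc_eq_Ioc hs hst] at this
  simp only [gammaIntegral, this]
  ring

/-- The bound is chosen so that adding the exceptional probability `2 / 25` leaves `0.49 < 1 / 2`.
-/
lemma exp_neg_nine_tenths_lt : Real.exp (-(9 / 10)) < 41 / 100 := by
  have h1 : Real.exp (-(9 / 10)) * Real.exp (-(1 / 10)) = Real.exp (-1) := by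
    rw [← Real.exp_add]
    norm_num
  have h2 := Real.add_one_le_exp (-(1 / 10))
  have h3 := Real.exp_neg_one_lt_d9
  have h4 := Real.exp_pos (-(9 / 10))
  nlinarith

/-- If the integrals up to `t - 1` and up to `t` are both close to their means outside small
events, then the interval `(t - 1, t]` carries a small proportion of the mean. -/
lemma IsGammaProcess.lt_lRatio (hΓ : IsGammaProcess Γ P) (hf0 : ∀ x, 0 < x → 0 ≤ f x)
    (hf : ∀ t, 0 < t → IntegrableOn f (Ioc 0 t) volume) {ε t : ℝ} (hε : 0 < ε) (ht : 1 < t)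
    (hpos : 0 < lam f (t - 1))
    (h0 : P.real {ω | ε / 20 ≤ |gammaIntegral Γ f (t - 1) ω / lam f (t - 1) - 1|} < 1 / 25)
    (h1 : P.real {ω | ε / 20 ≤ |gammaIntegral Γ f t ω / lam f t - 1|} < 1 / 25) :
    1 - ε < lRatio f t := by
  by_contra! hle
  have hs : 0 ≤ t - 1 := by linarith
  have hmono : lam f (t - 1) ≤ lam f t := lam_mono hf0 hf (by linarith)
  have hpos' : 0 < lam f t := hpos.trans_le hmono
  obtain ⟨κ, hκ, hmean⟩ := hΓ.exists_kernel (a := t - 1) (b := t - 1 + 1) hs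
  set d := lam f t - lam f (t - 1) with hd
  have hdε : ε * lam f t ≤ d := by
    rw [lRatio, div_le_iff₀ hpos'] at hle
    linarith
  have hd0 : 0 < d := (mul_pos hε hpos').trans_le hdε
  have hdint : ∫ x in Ioc (t - 1) (t - 1 + 1), f x = d := by
    rw [sub_add_cancel, hd, lam_sub_lam hf hs (by linarith)]
  have hfI : IntegrableOn f (Ioc (t - 1) (t - 1 + 1)) := by
    rw [sub_add_cancel]
    exact (hf t (by linarith)).mono_set (Ioc_subset_Ioc_left hs)
  have hg0 : ∀ x ∈ Ioc (t - 1) (t - 1 + 1), 0 ≤ f x / d := fun x hx =>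
    div_nonneg (hf0 x (hs.trans_lt hx.1)) hd0.le
  have hgI : IntegrableOn (fun x => f x / d) (Ioc (t - 1) (t - 1 + 1)) := hfI.div_const d
  have hlow := hΓ.le_integral_exp_neg hs hκ hmean hgI hg0
  -- After scaling by `d` the integral is one, and the lower bound becomes `1 / 2`.
  rw [integral_div, hdint, div_self hd0.ne'] at hlow
  set B₀ := {ω | ε / 20 ≤ |gammaIntegral Γ f (t - 1) ω / lam f (t - 1) - 1|} with hB₀
  set B₁ := {ω | ε / 20 ≤ |gammaIntegral Γ f t ω / lam f t - 1|} with hB₁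
  -- A measurable hull avoids proving that the exceptional events are measurable, at no cost in
  -- probability.
  set B := toMeasurable P (B₀ ∪ B₁) with hB
  have hBm : MeasurableSet B := measurableSet_toMeasurable _ _
  have hBP : P.real B ≤ 2 / 25 := by
    have h2 : P.real B = P.real (B₀ ∪ B₁) := by simp [measureReal_def, hB, measure_toMeasurable]
    have h3 := measureReal_union_le (μ := P) B₀ B₁
    linarith
  have hgκ : Integrable (fun x => f x / d) (κ ∘ₘ P) := by rwa [hmean]
  have hgκ0 : ∀ᵐ x ∂(κ ∘ₘ P), 0 ≤ f x / d := by
    rw [hmean]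
    exact (ae_restrict_mem measurableSet_Ioc).mono hg0
  have hup : ∫ ω, Real.exp (-∫ x, f x / d ∂κ ω) ∂P ≤
      ∫ ω, (Real.exp (-(9 / 10)) + B.indicator (fun _ => (1 : ℝ)) ω) ∂P := by
    refine integral_mono_ae (integrable_exp_neg_integral hgκ hgκ0)
      ((integrable_const _).add ((integrable_const _).indicator hBm)) ?_
    filter_upwards [hκ, ae_integral_nonneg hgκ0,
      hΓ.ae_gammaIntegral_sub hf hs (by linarith : t - 1 ≤ t) (by linarith)] with ω h2 h3 h4
    by_cases hω : ω ∈ B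
    · rw [indicator_of_mem hω]
      have h5 : Real.exp (-∫ x, f x / d ∂κ ω) ≤ 1 := Real.exp_le_one_iff.2 (by linarith)
      have := Real.exp_pos (-(9 / 10))
      linarith
    · rw [indicator_of_notMem hω, add_zero, Real.exp_le_exp, neg_le_neg_iff]
      have h5 : ω ∉ B₀ ∪ B₁ := fun h => hω (subset_toMeasurable _ _ h)
      simp only [mem_union, not_or, hB₀, hB₁, mem_ofPred_eq, not_le] at h5
      obtain ⟨h6, h7⟩ := h5
      -- Off `B`, the increment exceeds `(1 - ε/20) λ_t f - (1 + ε/20) λ_{t-1} f ≥ d - (ε/10) λ_t f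
      -- ≥ (9/10) d`.
      have h6' := (abs_lt.1 h6).2
      have h7' := (abs_lt.1 h7).1
      rw [sub_lt_iff_lt_add, div_lt_iff₀ hpos] at h6'
      rw [lt_sub_iff_add_lt, lt_div_iff₀ hpos'] at h7'
      rw [integral_div, h2, sub_add_cancel, ← h4, le_div_iff₀ hd0]
      have h8 : ε / 20 * lam f (t - 1) ≤ ε / 20 * lam f t := by gcongr
      linarith
  rw [integral_add (integrable_const _) ((integrable_const _).indicator hBm),
    integral_indicator_const _ hBm] at hup
  simp only [integral_const, probReal_univ, smul_eq_mul, one_mul, mul_one] at hup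
  have := exp_neg_nine_tenths_lt
  norm_num at hlow
  linarith

lemma IsGammaProcess.tendsto_lRatio (hΓ : IsGammaProcess Γ P) (hf0 : ∀ x, 0 < x → 0 ≤ f x)
    (hf : ∀ t, 0 < t → IntegrableOn f (Ioc 0 t) volume) (hOD : OrderlyDivergent Γ P f) :
    Tendsto (lRatio f) atTop (𝓝 1) := by
  refine tendsto_order.2 ⟨fun a ha => ?_, fun a ha =>
    Eventually.of_forall fun t => (lRatio_le_one hf0 hf t).trans_lt ha⟩
  have hε : 0 < 1 - a := sub_pos.2 ha
  have hprob := (tendstoInMeasure_iff_measureReal_norm.1 hOD.2 ((1 - a) / 20)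
    (by positivity)).eventually_lt_const (by norm_num : (0 : ℝ) < 1 / 25)
  have hshift : Tendsto (fun t : ℝ => t - 1) atTop atTop :=
    tendsto_atTop_add_const_right atTop (-1) tendsto_id
  filter_upwards [hprob, hshift.eventually hprob, eventually_gt_atTop 1,
    hshift.eventually (hOD.1.eventually_gt_atTop 0)] with t h1 h0 ht hpos
  have := hΓ.lt_lRatio hf0 hf hε ht hpos h0 h1
  linarith

end Divergence

end GammaOD

/-- For nonnegative `f`, `∃ t, 0 < lam f t` expresses that `f` is not almost everywhere zero on `(0,
∞)`. -/
theorem mainTheorem4 (f : ℝ → ℝ) (hf_nonneg : ∀ x, 0 < x → 0 ≤ f x)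
    (hf_loc : ∀ t, 0 < t → IntegrableOn f (Ioc 0 t) volume) :
    (∀ (Ω : Type*) [MeasurableSpace Ω] (P : Measure Ω) [IsProbabilityMeasure P]
        (Γ : ℝ≥0 → Ω → ℝ), GammaOD.IsGammaProcess Γ P →
        GammaOD.OrderlyDivergent Γ P f → Tendsto (GammaOD.lRatio f) atTop (𝓝 1)) ∧
    ((∀ t, 0 < t → MemLp f 2 (volume.restrict (Ioc 0 t))) → Tendsto f atTop atTop →
        Tendsto (GammaOD.bRatio f) atTop (𝓝 0) → Tendsto (GammaOD.vRatio f) atTop (𝓝 0)) ∧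
    ((MonotoneOn f (Ioi 0) ∨ AntitoneOn f (Ioi 0)) → (∃ t, 0 < GammaOD.lam f t) →
        (Tendsto (GammaOD.lRatio f) atTop (𝓝 1) ↔ Tendsto (GammaOD.bRatio f) atTop (𝓝 0))) := by
  refine ⟨fun Ω _ P _ Γ hΓ hOD => hΓ.tendsto_lRatio hf_nonneg hf_loc hOD,
    fun h2 htop hb => GammaOD.tendsto_vRatio hf_nonneg hf_loc h2
      (GammaOD.tendsto_lam_atTop hf_nonneg hf_loc htop) hb, ?_⟩
  rintro (hmono | hanti) hpos
  · exact GammaOD.tendsto_lRatio_iff_of_monotoneOn hf_nonneg hf_loc hmono hpos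
  · exact iff_of_true (GammaOD.tendsto_lRatio_of_antitoneOn hf_nonneg hf_loc hanti hpos)
      (GammaOD.tendsto_bRatio_of_antitoneOn hf_nonneg hf_loc hanti hpos)
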